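/- Let $d\in\mathbb N$, $p\in[1,\infty]$, and equip the input space $\mathcal X=\mathbb R^d$ with the metric $\|x-x'\|_p$. Let $\theta^*\in\mathbb R^d$, let $\Sigma^*\in\mathbb R^{d\times d}$ be positive definite, and let $\mu_{XY}$ be the law on $\mathbb R^d\times\{-1,1\}$ of $(x,y)$, where $y$ is uniform on $\{-1,1\}$ and, given $y$, $x\sim\mathcal N(y\theta^*,\Sigma^*)$; let $\mu_X$ be its first marginal. Let $\mathrm{sgn}(t)=1$ if $t\ge 0$ and $\mathrm{sgn}(t)=-1$ otherwise. Fix $w\in\mathbb R^d$ with $\|w\|_2=1$, the representation $g(x)=\mathrm{sgn}(w^\top x)$ with values in $\{-1,1\}$, and $\varepsilon\ge 0$. For a classifier $f:\mathbb R^d\to\{-1,1\}$ put $\mathrm{AdvRisk}_\varepsilon(f)=\Pr_{(x,y)\sim\mu_{XY}}[\exists x':\ \|x'-x\|_p\le\varepsilon,\ f(x')\ne y]$, $\mathrm{Risk}(f)=\Pr_{(x,y)\sim\mu_{XY}}[f(x)\neq y]$ and $\mathrm{AG}_\varepsilon(f)=\mathrm{AdvRisk}_\varepsilon(f)-\mathrm{Risk}(f)$.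 Let $$\mathrm{RV}_\varepsilon(g)=\sup\big\{\mathrm I(X;g(X))-\mathrm I(X';g(X'))\ :\ X\sim\mu_X,\ X'\sim\mu',\ \mathrm W_\infty(\mu',\mu_X)\le\varepsilon\big\},$$ where $\mu'$ ranges over probability measures on $\mathbb R^d$, $\mathrm I$ is mutual information (the Kullback–Leibler divergence of the joint law from the product of its marginals), and $\mathrm W_\infty(\mu',\mu)$ is the $\infty$-Wasserstein distance, i.e. the infimum over couplings $\gamma$ of $\mu'$ and $\mu$ of the $\gamma$-essential supremum of $\|x-x'\|_p$. Let $\mathrm H_2(t)=-t\log t-(1-t)\log(1-t)$ be the binary entropy on $[0,1]$, with $0\log 0=0$ and with the same logarithm as in $\mathrm I$. Let $f^*=h^*\circ g$, where $h^*$ minimizes $\mathrm{AdvRisk}_\varepsilon(h\circ g)$ over the non-constant maps $h:\{-1,1\}\to\{-1,1\}$. Then $$\int_{\frac12-\frac12\mathrm{AG}_\varepsilon(f^*)}^{\frac12}\mathrm H_2'(t)\,dt\ \le\ \mathrm{RV}_\varepsilon(g)\ \le\ \int_{\max\{0,\ \frac12-\mathrm{AG}_\varepsilon(f^*)\}}^{\frac12}\mathrm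 H_2'(t)\,dt .$$ (An integral $\int_a^{1/2}\mathrm H_2'(t)\,dt$ with $0\le a\le\frac12$ equals $\mathrm H_2(\tfrac12)-\mathrm H_2(a)$.) -/

import Mathlib

open MeasureTheory ProbabilityTheory
open scoped ENNReal

noncomputable section

namespace RepVuln

section General

variable {X Y Z : Type*} [PseudoMetricSpace X] [MeasurableSpace X] [MeasurableSpace Y]
  [MeasurableSpace Z]

/-- Mutual information of a pair of random variables with joint law `ρ`: the Kullback-Leibler
divergence of `ρ` from the product of its marginals. -/
def mutualInfo (ρ : Measure (X × Z)) : ℝ≥0∞ :=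
  InformationTheory.klDiv ρ (ρ.fst.prod ρ.snd)

/-- `I(X; g(X))` for a random variable `X` with law `μ`. -/
def inputOutputInfo (μ : Measure X) (g : X → Z) : ℝ≥0∞ :=
  mutualInfo (μ.map fun x => (x, g x))

/-- The couplings `Γ(μ, ν)` of two measures. -/
def couplings (μ ν : Measure X) : Set (Measure (X × X)) :=
  {γ | IsProbabilityMeasure γ ∧ γ.fst = μ ∧ γ.snd = ν}

/-- The `∞`-Wasserstein distance: infimum over couplings of the essential supremum of the
distance. -/
def wInfty (μ ν : Measure X) : ℝ≥0∞ :=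
  ⨅ γ ∈ couplings μ ν, essSup (fun z : X × X => edist z.1 z.2) γ

/-- The probability measures at `∞`-Wasserstein distance at most `ε` from `μ`. -/
def wInftyBall (μ : Measure X) (ε : ℝ) : Set (Measure X) :=
  {μ' | IsProbabilityMeasure μ' ∧ wInfty μ' μ ≤ ENNReal.ofReal ε}

/-- Representation vulnerability of `g`: the largest loss `I(X; g(X)) - I(X'; g(X'))` of mutual
information over input laws `μ'` in the `∞`-Wasserstein ball. It is an extended real, so that the
supremum needs no boundedness proviso. -/
def repVulnerability (μ : Measure X) (ε : ℝ) (g : X → Z) : EReal :=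
  ⨆ μ' ∈ wInftyBall μ ε, ((inputOutputInfo μ g : EReal) - (inputOutputInfo μ' g : EReal))

/-- Standard risk `Pr[f(x) ≠ y]`. -/
def risk (ρ : Measure (X × Y)) (f : X → Y) : ℝ :=
  ρ.real {z | f z.1 ≠ z.2}

/-- Adversarial risk `Pr[∃ x' ∈ B(x, ε), f(x') ≠ y]`, with closed balls. -/
def advRisk (ρ : Measure (X × Y)) (ε : ℝ) (f : X → Y) : ℝ :=
  ρ.real {z | ∃ x' ∈ Metric.closedBall z.1 ε, f x' ≠ z.2}

/-- Adversarial gap. -/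
def advGap (ρ : Measure (X × Y)) (ε : ℝ) (f : X → Y) : ℝ :=
  advRisk ρ ε f - risk ρ f

/-- A downstream classifier is non-trivial if it is not a constant function. -/
def NonTrivial (h : Z → Y) : Prop := ¬ ∃ c, ∀ z, h z = c

/-- `h` minimizes the adversarial risk of `h ∘ g` among the non-trivial downstream classifiers. -/
def IsOptimalDownstream (ρ : Measure (X × Y)) (ε : ℝ) (g : X → Z) (h : Z → Y) : Prop :=
  NonTrivial h ∧ ∀ h' : Z → Y, NonTrivial h' → advRisk ρ ε (h ∘ g) ≤ advRisk ρ ε (h' ∘ g)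

end General

/-- The sign function with `sgn 0 = 1`; the two-point set `{-1, 1}` is the unit group `ℤˣ`. -/
def sgn (t : ℝ) : ℤˣ := if 0 ≤ t then 1 else -1

/-- The representation `x ↦ sgn(wᵀx)` on `ℝᵈ` with the `ℓ_p` metric. -/
def linearSign {d : ℕ} (p : ℝ≥0∞) (w : EuclideanSpace ℝ (Fin d)) :
    PiLp p (fun _ : Fin d => ℝ) → ℤˣ :=
  fun x => sgn (∑ i, w i * x i)

/-- The joint law of `(x, y)` with `y` uniform on `{-1, 1}` and `x ∼ N(y θ, S)` given `y`, as a
measure on `(ℝᵈ, ℓ_p) × {-1, 1}`. -/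
def gaussianMixture {d : ℕ} (p : ℝ≥0∞) (θ : EuclideanSpace ℝ (Fin d))
    (S : Matrix (Fin d) (Fin d) ℝ) : Measure (PiLp p (fun _ : Fin d => ℝ) × ℤˣ) :=
  ∑ y : ℤˣ, (2⁻¹ : ℝ≥0∞) •
    (multivariateGaussian (((y : ℤ) : ℝ) • θ) S).map (fun x => (WithLp.toLp p x.ofLp, y))

end RepVuln

end

namespace RepVuln

/-! Write L for the form x ↦ wᵀx, ‖L‖ for its dual norm, c = ‖L‖ε, and F for the cdf of L under the
input law. Both sides reduce to one-dimensional Gaussian masses. Since g is a function of the input,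
I(X; g(X)) is the entropy of g(X) (`inputOutputInfo_eq_entropy`), here H₂ of the mass of {0 ≤ L}.
The projected mixture is symmetric, so the unperturbed information is log 2. A W∞-perturbation of
size ε moves L by at most c, and translating in a norming direction attains this, so the
vulnerability is exactly log 2 - H₂(F(c)) (`repVulnerability_sgn`). A non-constant h is
multiplication by some k = ±1, and its adversarial risk is N(b, v)(-∞, c] with b = k⟨w, θ⟩
(`advRisk_gaussianMixture`). Optimality forces b ≥ 0, and the gap is AG = N(b, v)(0, c]. On the
other side, F(c) - 1/2 is the average of N(b, v)(0, c] and N(-b, v)(0, c]. The second mass lies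
between 0 and the first (`gaussianReal_real_Ioc_le`), so AG/2 ≤ F(c) - 1/2 ≤ AG. Monotonicity of H₂
on [0, 1/2] concludes. -/

instance : MeasurableSingletonClass ℤˣ where
  measurableSet_singleton u := by
    refine ⟨{(u : ℤ)}, measurableSet_singleton _, ?_⟩
    ext z
    simp [Units.ext_iff]

/-! ### Mutual information of a deterministic finite-valued representation -/

section Information

variable {X Z : Type*} [MeasurableSpace X] [MeasurableSpace Z] [Finite Z]
  [MeasurableSingletonClass Z]

/-- The density of the law of `(x, g x)` with respect to the product of its marginals. -/
noncomputable def graphDensity (μ : Measure X) (g : X → Z) (z : X × Z) : ℝ≥0∞ :=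
  {z : X × Z | z.2 = g z.1}.indicator (fun z => (μ.map g {z.2})⁻¹) z

lemma measurable_graphDensity (μ : Measure X) {g : X → Z} (hg : Measurable g) :
    Measurable (graphDensity μ g) := by
  refine Measurable.indicator ?_ (measurableSet_eq_fun measurable_snd (hg.comp measurable_fst))
  exact (measurable_of_finite (fun z : Z => (μ.map g {z})⁻¹)).comp measurable_snd

/-- By Tonelli: the fibre over x meets the graph only at g x, whose mass cancels against the
density. Values of mass zero, where the inverse is infinite, are almost surely not taken. -/
lemma map_graph_eq_withDensity (μ : Measure X) [IsProbabilityMeasure μ] {g : X → Z}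
    (hg : Measurable g) :
    μ.map (fun x => (x, g x)) = (μ.prod (μ.map g)).withDensity (graphDensity μ g) := by
  have : IsProbabilityMeasure (μ.map g) := Measure.isProbabilityMeasure_map hg.aemeasurable
  have hgr : Measurable fun x => (x, g x) := measurable_id.prodMk hg
  have hpos : ∀ᵐ x ∂μ, μ.map g {g x} ≠ 0 := by
    refine ae_of_ae_map hg.aemeasurable (p := fun z => μ.map g {z} ≠ 0) ?_
    rw [ae_iff]
    have : {z | ¬ μ.map g {z} ≠ 0} = ⋃ z ∈ {z | μ.map g {z} = 0}, {z} := by ext; simp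
    rw [this, measure_biUnion_null_iff (Set.to_countable _)]
    exact fun z hz => hz
  ext s hs
  rw [Measure.map_apply hgr hs, withDensity_apply _ hs, ← lintegral_indicator hs,
    lintegral_prod _ ((measurable_graphDensity μ hg).indicator hs).aemeasurable,
    ← lintegral_indicator_one (hgr hs)]
  refine lintegral_congr_ae ?_
  filter_upwards [hpos] with x hx
  have hz : ∀ z, s.indicator (graphDensity μ g) (x, z) =
      ({g x} : Set Z).indicator (fun z => s.indicator (fun _ => (μ.map g {g x})⁻¹) (x, g x)) z := by
    intro z
    by_cases hzg : z = g x
    · subst hzg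
      by_cases hxs : (x, g x) ∈ s <;> simp [graphDensity, hxs]
    · simp [graphDensity, hzg]
  simp_rw [hz]
  rw [lintegral_indicator (measurableSet_singleton _), setLIntegral_const]
  by_cases hxs : (x, g x) ∈ s
  · simp [hxs, ENNReal.inv_mul_cancel hx (measure_ne_top _ _)]
  · simp [hxs]

/-- For a finitely valued `g`, the mutual information `I(X; g(X))` is the entropy of `g(X)`. -/
theorem inputOutputInfo_eq_entropy [PseudoMetricSpace X] [Fintype Z] (μ : Measure X)
    [IsProbabilityMeasure μ] {g : X → Z} (hg : Measurable g) :
    inputOutputInfo μ g = ENNReal.ofReal (∑ z, Real.negMulLog (μ.real (g ⁻¹' {z}))) := by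
  have : IsProbabilityMeasure (μ.map g) := Measure.isProbabilityMeasure_map hg.aemeasurable
  have hgr : Measurable fun x => (x, g x) := measurable_id.prodMk hg
  have : IsProbabilityMeasure (μ.map fun x => (x, g x)) :=
    Measure.isProbabilityMeasure_map hgr.aemeasurable
  have hfst : (μ.map fun x => (x, g x)).fst = μ := by
    rw [Measure.fst_map_prodMk hg]; exact Measure.map_id
  have hsnd : (μ.map fun x => (x, g x)).snd = μ.map g := Measure.snd_map_prodMk measurable_id
  have hmap : (μ.map fun x => (x, g x)).map Prod.snd = μ.map g := hsnd
  have hdens := map_graph_eq_withDensity μ hg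
  have hac : μ.map (fun x => (x, g x)) ≪ μ.prod (μ.map g) := by
    rw [hdens]; exact withDensity_absolutelyContinuous _ _
  have hllr : llr (μ.map fun x => (x, g x)) (μ.prod (μ.map g))
      =ᵐ[μ.map fun x => (x, g x)] fun z => - Real.log ((μ.map g).real {z.2}) := by
    have h1 := hac.ae_le (Measure.rnDeriv_withDensity (μ.prod (μ.map g))
      (measurable_graphDensity μ hg))
    rw [← hdens] at h1
    have h2 : ∀ᵐ z ∂(μ.map fun x => (x, g x)), z.2 = g z.1 := by
      refine (ae_map_iff hgr.aemeasurable
        (measurableSet_eq_fun measurable_snd (hg.comp measurable_fst))).2 ?_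
      simp
    filter_upwards [h1, h2] with z hz1 hz2
    rw [llr, hz1, graphDensity, Set.indicator_of_mem (by exact hz2), ENNReal.toReal_inv,
      Real.log_inv, measureReal_def]
  have hcomp : Integrable (fun z : Z => - Real.log ((μ.map g).real {z})) (μ.map g) :=
    Integrable.of_finite
  have hint : Integrable (fun z : X × Z => - Real.log ((μ.map g).real {z.2}))
      (μ.map fun x => (x, g x)) := by
    refine Integrable.comp_measurable (g := fun z : Z => - Real.log ((μ.map g).real {z})) ?_
      measurable_snd
    rwa [hmap]
  rw [inputOutputInfo, mutualInfo, hfst, hsnd,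
    InformationTheory.klDiv_of_ac_of_integrable hac (hint.congr hllr.symm),
    integral_congr_ae hllr]
  have : ∫ z : X × Z, - Real.log ((μ.map g).real {z.2}) ∂(μ.map fun x => (x, g x)) =
      ∫ z, - Real.log ((μ.map g).real {z}) ∂(μ.map g) := by
    refine .trans ?_ (congrArg (fun π => ∫ z, - Real.log ((μ.map g).real {z}) ∂π) hmap)
    rw [integral_map measurable_snd.aemeasurable (measurable_of_finite _).aestronglyMeasurable]
  rw [this, integral_fintype hcomp]
  simp only [probReal_univ, add_sub_cancel_right, smul_eq_mul, Real.negMulLog,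
    map_measureReal_apply hg (measurableSet_singleton _), neg_mul, mul_neg]

theorem inputOutputInfo_eq_binEntropy [PseudoMetricSpace X] (μ : Measure X)
    [IsProbabilityMeasure μ] {g : X → ℤˣ} (hg : Measurable g) :
    inputOutputInfo μ g = ENNReal.ofReal (Real.binEntropy (μ.real (g ⁻¹' {1}))) := by
  have hc : g ⁻¹' {-1} = (g ⁻¹' {1})ᶜ := by
    ext x
    rcases Int.units_eq_one_or (g x) with h | h <;> simp [h]
  rw [inputOutputInfo_eq_entropy μ hg, Real.binEntropy_eq_negMulLog_add_negMulLog_one_sub,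
    ← probReal_compl_eq_one_sub (hg (measurableSet_singleton _)), ← hc]
  rw [show (Finset.univ : Finset ℤˣ) = {1, -1} from rfl, Finset.sum_pair (by decide)]

end Information

/-! ### Binary entropy and the sign function -/

lemma integral_deriv_binEntropy {a : ℝ} (ha : 0 ≤ a) (ha' : a ≤ 1 / 2) :
    ∫ t in a..(1 / 2), deriv Real.binEntropy t = Real.log 2 - Real.binEntropy a := by
  rw [intervalIntegral.integral_eq_sub_of_hasDerivAt_of_le ha'
    Real.binEntropy_continuous.continuousOn]
  · rw [one_div, Real.binEntropy_two_inv]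
  · intro x hx
    exact (Real.differentiableAt_binEntropy (by linarith [hx.1]) (by linarith [hx.2])).hasDerivAt
  -- For a = 0 the derivative is unbounded, but its logarithmic singularity is integrable.
  · rw [show deriv Real.binEntropy = fun t => Real.log (1 - t) - Real.log t from
      funext Real.deriv_binEntropy]
    refine IntervalIntegrable.sub ?_ intervalIntegral.intervalIntegrable_log'
    have := (intervalIntegral.intervalIntegrable_log' (a := 1 - a) (b := 1 - 1 / 2)).comp_sub_left 1
    simpa using this

lemma binEntropy_le_of_le_of_one_sub_le {q r : ℝ} (hr : r ≤ 1) (hr' : 1 / 2 ≤ r) (hq : q ≤ r)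
    (hq' : 1 - q ≤ r) : Real.binEntropy r ≤ Real.binEntropy q := by
  have hmono := Real.binEntropy_strictAntiOn.antitoneOn
  rcases le_total (1 / 2) q with h | h
  · exact hmono ⟨by linarith, by linarith⟩ ⟨by linarith, by linarith⟩ hq
  · rw [← Real.binEntropy_one_sub q]
    exact hmono ⟨by linarith, by linarith⟩ ⟨by linarith, by linarith⟩ hq'

lemma measurable_sgn : Measurable sgn :=
  Measurable.ite measurableSet_Ici measurable_const measurable_const

lemma sgn_eq_one_iff {t : ℝ} : sgn t = 1 ↔ 0 ≤ t := by
  unfold sgn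
  split_ifs with h <;> simp [h]

lemma sgn_ne_one_iff {t : ℝ} : sgn t ≠ 1 ↔ t < 0 := by
  rw [Ne, sgn_eq_one_iff, not_le]

lemma sgn_ne_neg_one_iff {t : ℝ} : sgn t ≠ -1 ↔ 0 ≤ t := by
  rw [← sgn_eq_one_iff, Int.units_ne_iff_eq_neg, neg_neg]

/-! ### Membership in the ∞-Wasserstein ball -/

section Coupling

variable {X : Type*} [PseudoMetricSpace X] [MeasurableSpace X] {μ μ' : Measure X} {ε : ℝ}

/-- The slack δ > ε avoids needing an optimal coupling: some coupling has essential supremum below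
δ, and almost surely it carries A into B. -/
lemma measure_le_of_mem_wInftyBall (h : μ' ∈ wInftyBall μ ε) (hε : 0 ≤ ε) {δ : ℝ} (hδ : ε < δ)
    {A B : Set X} (hA : MeasurableSet A) (hB : MeasurableSet B)
    (hAB : ∀ x ∈ A, ∀ y, dist x y ≤ δ → y ∈ B) : μ' A ≤ μ B := by
  have hlt : wInfty μ' μ < ENNReal.ofReal δ :=
    h.2.trans_lt ((ENNReal.ofReal_lt_ofReal_iff (hε.trans_lt hδ)).2 hδ)
  simp only [wInfty, iInf_lt_iff] at hlt
  obtain ⟨γ, ⟨hγ, h1, h2⟩, hlt⟩ := hlt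
  rw [← h1, ← h2, Measure.fst_apply hA, Measure.snd_apply hB]
  refine measure_mono_ae ?_
  filter_upwards [ENNReal.ae_le_essSup fun z : X × X => edist z.1 z.2] with z hz hzA
  refine hAB z.1 hzA z.2 ?_
  have := hz.trans hlt.le
  rwa [edist_dist, ENNReal.ofReal_le_ofReal_iff (hε.trans hδ.le)] at this

lemma map_mem_wInftyBall [OpensMeasurableSpace X] [SecondCountableTopology X] [IsProbabilityMeasure μ] {T : X → X}
    (hT : Measurable T) (hdist : ∀ x, dist (T x) x ≤ ε) : μ.map T ∈ wInftyBall μ ε := by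
  have hp : Measurable fun x => (T x, x) := hT.prodMk measurable_id
  refine ⟨Measure.isProbabilityMeasure_map hT.aemeasurable, ?_⟩
  refine (iInf₂_le (μ.map fun x => (T x, x))
    ⟨Measure.isProbabilityMeasure_map hp.aemeasurable, Measure.fst_map_prodMk measurable_id,
      (Measure.snd_map_prodMk hT).trans Measure.map_id⟩).trans ?_
  · have hae : ∀ᵐ z ∂(μ.map fun x => (T x, x)), edist z.1 z.2 ≤ ENNReal.ofReal ε := by
      refine (ae_map_iff hp.aemeasurable
        (measurableSet_le measurable_edist measurable_const)).2 (ae_of_all _ fun x => ?_)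
      rw [edist_dist]
      exact ENNReal.ofReal_le_ofReal (hdist x)
    exact essSup_le_of_ae_le _ hae

end Coupling

/-! ### Half-spaces under perturbation and the exact vulnerability -/

section HalfSpace

lemma real_Ici_neg_eq {ν : Measure ℝ} (hsymm : ν.map Neg.neg = ν) (t : ℝ) :
    ν.real (Set.Ici (-t)) = ν.real (Set.Iic t) := by
  conv_lhs => rw [← hsymm]
  rw [map_measureReal_apply measurable_neg measurableSet_Ici]
  congr 1
  ext x
  simp

variable {E : Type*} [NormedAddCommGroup E] [NormedSpace ℝ E] (L : E →L[ℝ] ℝ)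
  {ε : ℝ}

lemma abs_apply_sub_le {x y : E} (h : dist x y ≤ ε) : |L x - L y| ≤ ‖L‖ * ε := by
  rw [← map_sub]
  refine (L.le_opNorm _).trans ?_
  rw [← dist_eq_norm]
  gcongr

/-- The range of the mass of the half-space `{0 ≤ L x}` over an `∞`-Wasserstein ball. -/
lemma measureReal_halfSpace_le [MeasurableSpace E] [BorelSpace E] {μ μ' : Measure E} [IsProbabilityMeasure μ]
    (hsymm : (μ.map L).map Neg.neg = μ.map L) (hε : 0 ≤ ε) (h : μ' ∈ wInftyBall μ ε) :
    μ'.real {x | 0 ≤ L x} ≤ (μ.map L).real (Set.Iic (‖L‖ * ε)) ∧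
      μ'.real {x | L x < 0} ≤ (μ.map L).real (Set.Iic (‖L‖ * ε)) := by
  have hL : Measurable L := L.continuous.measurable
  have : IsProbabilityMeasure (μ.map L) := Measure.isProbabilityMeasure_map hL.aemeasurable
  have := h.1
  -- Coupling bounds hold only for δ > ε; right-continuity of the cdf lets δ decrease to ε.
  have hlim : Filter.Tendsto (fun δ => cdf (μ.map L) (‖L‖ * δ)) (nhdsWithin ε (Set.Ioi ε))
      (nhds (cdf (μ.map L) (‖L‖ * ε))) := by
    have hc := (cdf (μ.map L)).right_continuous (‖L‖ * ε)
    refine hc.tendsto.comp (tendsto_nhdsWithin_iff.2 ⟨?_, ?_⟩)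
    · exact ((continuous_const_mul _).tendsto ε).mono_left nhdsWithin_le_nhds
    · filter_upwards [self_mem_nhdsWithin] with δ hδ
      exact mul_le_mul_of_nonneg_left (le_of_lt hδ) (norm_nonneg L)
  rw [← cdf_eq_real]
  constructor
  · refine ge_of_tendsto hlim ?_
    filter_upwards [self_mem_nhdsWithin] with δ hδ
    rw [cdf_eq_real, ← real_Ici_neg_eq hsymm, map_measureReal_apply hL measurableSet_Ici]
    refine ENNReal.toReal_mono (measure_ne_top _ _) (measure_le_of_mem_wInftyBall h hε hδ
      (hL measurableSet_Ici) (hL measurableSet_Ici) fun x hx y hxy => ?_)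
    have := (abs_le.1 (abs_apply_sub_le L hxy)).2
    simp only [Set.mem_preimage, Set.mem_Ici, Set.mem_ofPred_eq] at hx ⊢
    linarith
  · refine ge_of_tendsto hlim ?_
    filter_upwards [self_mem_nhdsWithin] with δ hδ
    rw [cdf_eq_real, map_measureReal_apply hL measurableSet_Iic]
    refine ENNReal.toReal_mono (measure_ne_top _ _) (measure_le_of_mem_wInftyBall h hε hδ
      (hL measurableSet_Iio) (hL measurableSet_Iic) fun x hx y hxy => ?_)
    have := (abs_le.1 (abs_apply_sub_le L hxy)).1
    simp only [Set.mem_preimage, Set.mem_Iic, Set.mem_ofPred_eq] at hx ⊢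
    linarith

variable [FiniteDimensional ℝ E]

/-- Compactness of the unit ball. Asking for norm at most 1 also covers the zero space. -/
lemma exists_norm_le_one_apply_eq_opNorm : ∃ v, ‖v‖ ≤ 1 ∧ L v = ‖L‖ := by
  have : ProperSpace E := FiniteDimensional.proper_real E
  obtain ⟨v, hv, hmax⟩ := (isCompact_closedBall (0 : E) 1).exists_isMaxOn
    ⟨0, by simp⟩ L.continuous.continuousOn
  have hv1 : ‖v‖ ≤ 1 := by simpa using hv
  refine ⟨v, hv1, le_antisymm ?_ ?_⟩
  · exact (le_abs_self _).trans (L.unit_le_opNorm v hv1)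
  · have h0 : ∀ x, ‖x‖ = 1 → L x ≤ L v := fun x hx => hmax (by simp [hx])
    refine L.opNorm_le_of_unit_norm (by simpa using hmax (a := 0) (by simp)) fun x hx => ?_
    refine abs_le.2 ⟨?_, h0 x hx⟩
    have := h0 (-x) (by simpa using hx)
    rw [map_neg] at this
    linarith

/-- The best attack moves x by ε along a norming vector, towards the wrong side. The strict and weak
inequalities reflect `sgn 0 = 1`. -/
lemma exists_sgn_ne_iff (hε : 0 ≤ ε) (x : E) (u : ℤˣ) :
    (∃ x' ∈ Metric.closedBall x ε, sgn (L x') ≠ u) ↔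
      if u = 1 then L x < ‖L‖ * ε else -(‖L‖ * ε) ≤ L x := by
  obtain ⟨v, hv, hLv⟩ := exists_norm_le_one_apply_eq_opNorm L
  have hball : ∀ t : ℝ, |t| = ε → x + t • v ∈ Metric.closedBall x ε := by
    intro t ht
    rw [Metric.mem_closedBall, dist_eq_norm, add_sub_cancel_left, norm_smul, Real.norm_eq_abs, ht]
    exact mul_le_of_le_one_right hε hv
  rcases Int.units_eq_one_or u with rfl | rfl
  · simp only [sgn_ne_one_iff, if_true]
    constructor
    · rintro ⟨x', hx', h⟩
      have := (abs_le.1 (abs_apply_sub_le L hx')).1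
      linarith
    · intro h
      refine ⟨x + (-ε) • v, hball _ (by rw [abs_neg, abs_of_nonneg hε]), ?_⟩
      rw [map_add, map_smul, hLv, smul_eq_mul]
      linarith
  · simp only [sgn_ne_neg_one_iff, if_neg (by decide : ¬ (-1 : ℤˣ) = 1)]
    constructor
    · rintro ⟨x', hx', h⟩
      have := (abs_le.1 (abs_apply_sub_le L hx')).2
      linarith
    · intro h
      refine ⟨x + ε • v, hball _ (abs_of_nonneg hε), ?_⟩
      rw [map_add, map_smul, hLv, smul_eq_mul]
      linarith

variable [MeasurableSpace E] [BorelSpace E]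

/-- The representation vulnerability of `x ↦ sgn (L x)` for an input law whose projection along `L`
is symmetric and atomless. -/
theorem repVulnerability_sgn {μ : Measure E} [IsProbabilityMeasure μ]
    (hsymm : (μ.map L).map Neg.neg = μ.map L)
    (hhalf : (μ.map L).real (Set.Iic 0) = 1 / 2) (hε : 0 ≤ ε) :
    repVulnerability μ ε (fun x => sgn (L x)) =
      ((Real.log 2 - Real.binEntropy ((μ.map L).real (Set.Iic (‖L‖ * ε))) : ℝ) : EReal) := by
  have hL : Measurable L := L.continuous.measurable
  have : IsProbabilityMeasure (μ.map L) := Measure.isProbabilityMeasure_map hL.aemeasurable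
  have hg : Measurable fun x => sgn (L x) := measurable_sgn.comp hL
  have hS : MeasurableSet {x | 0 ≤ L x} := hL measurableSet_Ici
  have hinfo : ∀ μ' : Measure E, IsProbabilityMeasure μ' →
      (inputOutputInfo μ' (fun x => sgn (L x)) : EReal) =
        (Real.binEntropy (μ'.real {x | 0 ≤ L x}) : ℝ) := by
    intro μ' _
    have hpre : (fun x => sgn (L x)) ⁻¹' {1} = {x | 0 ≤ L x} := by
      ext x
      simp [sgn_eq_one_iff]
    rw [inputOutputInfo_eq_binEntropy μ' hg, hpre, EReal.coe_ennreal_ofReal,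
      max_eq_left (Real.binEntropy_nonneg measureReal_nonneg measureReal_le_one)]
  have hμ : Real.binEntropy (μ.real {x | 0 ≤ L x}) = Real.log 2 := by
    have h0 := map_measureReal_apply (μ := μ) hL (measurableSet_Ici (a := (0 : ℝ)))
    have h1 := real_Ici_neg_eq hsymm 0
    rw [neg_zero, hhalf, h0] at h1
    rw [show {x | 0 ≤ L x} = L ⁻¹' Set.Ici 0 from rfl, h1, one_div, Real.binEntropy_two_inv]
  have hc : 1 / 2 ≤ (μ.map L).real (Set.Iic (‖L‖ * ε)) :=
    hhalf ▸ measureReal_mono (Set.Iic_subset_Iic.2 (by positivity))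
  rw [repVulnerability, hinfo μ inferInstance, hμ]
  refine le_antisymm (iSup₂_le fun μ' hμ' => ?_) ?_
  · have := hμ'.1
    rw [hinfo μ' hμ'.1, ← EReal.coe_sub, EReal.coe_le_coe_iff]
    obtain ⟨h1, h2⟩ := measureReal_halfSpace_le L hsymm hε hμ'
    refine sub_le_sub_left (binEntropy_le_of_le_of_one_sub_le measureReal_le_one hc h1 ?_) _
    rw [← probReal_compl_eq_one_sub hS]
    simpa only [Set.compl_ofPred, not_le] using h2
  · obtain ⟨v, hv, hLv⟩ := exists_norm_le_one_apply_eq_opNorm L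
    -- The extremal law is this translate: L increases everywhere by exactly ‖L‖ε.
    have hT : Measurable fun x : E => x + ε • v := by fun_prop
    have hmem : μ.map (fun x => x + ε • v) ∈ wInftyBall μ ε := by
      refine map_mem_wInftyBall hT fun x => ?_
      rw [dist_eq_norm, add_sub_cancel_left, norm_smul, Real.norm_eq_abs, abs_of_nonneg hε]
      exact mul_le_of_le_one_right hε hv
    refine le_iSup₂_of_le _ hmem ?_
    rw [hinfo _ hmem.1, ← EReal.coe_sub, EReal.coe_le_coe_iff,
      map_measureReal_apply hT hS, ← real_Ici_neg_eq hsymm,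
      map_measureReal_apply hL measurableSet_Ici]
    refine le_of_eq ?_
    congr 3
    ext x
    simp only [Set.mem_preimage, Set.mem_Ici, Set.mem_ofPred_eq, map_add, map_smul, hLv,
      smul_eq_mul]
    rw [neg_le_iff_add_nonneg, mul_comm]

end HalfSpace

/-! ### One-dimensional Gaussian masses -/

section Gaussian

variable {v : NNReal}

lemma gaussianReal_real_Iic_eq (b t : ℝ) :
    (gaussianReal b v).real (Set.Iic t) = (gaussianReal 0 v).real (Set.Iic (t - b)) := by
  have := gaussianReal_map_add_const (μ := 0) (v := v) b
  rw [zero_add] at this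
  rw [← this, map_measureReal_apply (by fun_prop) measurableSet_Iic]
  congr 1
  ext x
  simp [le_sub_iff_add_le]

lemma gaussianReal_real_Iio_eq (hv : v ≠ 0) (b t : ℝ) :
    (gaussianReal b v).real (Set.Iio t) = (gaussianReal b v).real (Set.Iic t) := by
  have := nullSingletonClass_gaussianReal (μ := b) hv
  exact measureReal_congr Iio_ae_eq_Iic

lemma gaussianReal_real_Ici_eq (b t : ℝ) :
    (gaussianReal b v).real (Set.Ici (-t)) = (gaussianReal (-b) v).real (Set.Iic t) := by
  rw [← gaussianReal_map_neg, map_measureReal_apply measurable_neg measurableSet_Iic]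
  congr 1
  ext x
  simp

lemma gaussianReal_real_Iic_lt (hv : v ≠ 0) (b : ℝ) {s t : ℝ} (hst : s < t) :
    (gaussianReal b v).real (Set.Iic s) < (gaussianReal b v).real (Set.Iic t) := by
  rw [← Set.Iic_union_Ioc_eq_Iic hst.le, measureReal_union (by
    rw [Set.disjoint_left]; intro x hx hx'; exact absurd hx'.1 (not_lt.2 hx)) measurableSet_Ioc]
  -- Lebesgue measure is absolutely continuous with respect to a nondegenerate Gaussian.
  have : (gaussianReal b v) (Set.Ioc s t) ≠ 0 := fun h => by
    have := gaussianReal_absolutelyContinuous' b hv h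
    simp [hst.not_ge] at this
  have : 0 < (gaussianReal b v).real (Set.Ioc s t) :=
    ENNReal.toReal_pos this (measure_ne_top _ _)
  linarith

/-- On the positive half-line the Gaussian with the positive mean dominates its mirror image. -/
lemma gaussianReal_real_Ioc_le (hv : v ≠ 0) {b : ℝ} (hb : 0 ≤ b) (c : ℝ) :
    (gaussianReal (-b) v).real (Set.Ioc 0 c) ≤ (gaussianReal b v).real (Set.Ioc 0 c) := by
  refine ENNReal.toReal_mono (measure_ne_top _ _) ?_
  rw [gaussianReal_apply _ hv, gaussianReal_apply _ hv]
  refine setLIntegral_mono (measurable_gaussianPDF _ _) fun x hx => ?_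
  refine ENNReal.ofReal_le_ofReal ?_
  rw [gaussianPDFReal, gaussianPDFReal]
  have hsq : (x - b) ^ 2 ≤ (x - -b) ^ 2 := by nlinarith [mul_nonneg hb hx.1.le]
  refine mul_le_mul_of_nonneg_left (Real.exp_le_exp.2 ?_) (by positivity)
  exact div_le_div_of_nonneg_right (neg_le_neg hsq) (by positivity)

end Gaussian

/-! ### The Gaussian mixture and its adversarial risk -/

section Mixture

variable {d : ℕ} (p : ℝ≥0∞)

/-- The linear form `x ↦ wᵀx` on `(ℝᵈ, ℓ_p)`. -/
noncomputable def linearForm (w : EuclideanSpace ℝ (Fin d)) :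
    PiLp p (fun _ : Fin d => ℝ) →L[ℝ] ℝ :=
  ∑ i, w i • PiLp.proj (𝕜 := ℝ) p (fun _ : Fin d => ℝ) i

lemma linearForm_apply (w : EuclideanSpace ℝ (Fin d)) (x : PiLp p (fun _ : Fin d => ℝ)) :
    linearForm p w x = ∑ i, w i * x i := by
  simp [linearForm]

/-- The law of `x` given `y`. -/
noncomputable def classLaw (θ : EuclideanSpace ℝ (Fin d)) (S : Matrix (Fin d) (Fin d) ℝ) (y : ℤˣ) :
    Measure (PiLp p (fun _ : Fin d => ℝ)) :=
  (multivariateGaussian (((y : ℤ) : ℝ) • θ) S).map fun x => WithLp.toLp p x.ofLp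

lemma measurable_toLp_ofLp :
    Measurable fun x : EuclideanSpace ℝ (Fin d) => WithLp.toLp p x.ofLp :=
  (WithLp.measurable_toLp p _).comp (WithLp.measurable_ofLp 2 _)

variable (θ w : EuclideanSpace ℝ (Fin d)) {S : Matrix (Fin d) (Fin d) ℝ}

instance (y : ℤˣ) : IsProbabilityMeasure (classLaw p θ S y) :=
  Measure.isProbabilityMeasure_map (measurable_toLp_ofLp p).aemeasurable

lemma map_linearForm_classLaw (hS : S.PosSemidef) (y : ℤˣ) :
    (classLaw p θ S y).map (linearForm p w) =
      gaussianReal (((y : ℤ) : ℝ) * inner ℝ w θ) (w.ofLp ⬝ᵥ S.mulVec w.ofLp).toNNReal := by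
  have hfun : linearForm p w ∘ (fun x : EuclideanSpace ℝ (Fin d) => WithLp.toLp p x.ofLp) =
      innerSL ℝ w := by
    ext x
    simp [linearForm_apply, PiLp.inner_apply, mul_comm]
  rw [classLaw, Measure.map_map (linearForm p w).continuous.measurable (measurable_toLp_ofLp p),
    hfun, IsGaussian.map_eq_gaussianReal, (innerSL ℝ w).integral_comp_id_comm IsGaussian.integrable_id, integral_id_multivariateGaussian,
    ← covarianceBilin_multivariateGaussian (μ := ((y : ℤ) : ℝ) • θ) hS w w,
    covarianceBilin_self IsGaussian.memLp_two_id]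
  simp

lemma gaussianMixture_eq :
    gaussianMixture p θ S =
      ∑ y : ℤˣ, (2⁻¹ : ℝ≥0∞) • (classLaw p θ S y).map (fun x => (x, y)) := by
  refine Finset.sum_congr rfl fun y _ => ?_
  rw [classLaw, Measure.map_map measurable_prodMk_right (measurable_toLp_ofLp p)]
  rfl

lemma gaussianMixture_real {A : Set (PiLp p (fun _ : Fin d => ℝ) × ℤˣ)} (hA : MeasurableSet A)
    (u : ℤˣ) :
    (gaussianMixture p θ S).real A = 1 / 2 * ((classLaw p θ S u).real {x | (x, u) ∈ A} +
      (classLaw p θ S (-u)).real {x | (x, -u) ∈ A}) := by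
  have hu : (Finset.univ : Finset ℤˣ) = {u, -u} := by
    rcases Int.units_eq_one_or u with rfl | rfl <;> decide
  have hne : u ≠ -u := by
    rcases Int.units_eq_one_or u with rfl | rfl <;> decide
  rw [gaussianMixture_eq, hu, Finset.sum_pair hne, measureReal_def, Measure.add_apply,
    Measure.smul_apply, Measure.smul_apply, Measure.map_apply measurable_prodMk_right hA,
    Measure.map_apply measurable_prodMk_right hA, smul_eq_mul, smul_eq_mul,
    ENNReal.toReal_add (by finiteness) (by finiteness)]
  simp only [ENNReal.toReal_mul, ENNReal.toReal_inv, ENNReal.toReal_ofNat]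
  rw [one_div, mul_add]
  rfl

instance : IsProbabilityMeasure (gaussianMixture p θ S) := by
  have h := gaussianMixture_real p θ (S := S) MeasurableSet.univ 1
  refine ⟨?_⟩
  rw [← ENNReal.toReal_eq_one_iff]
  refine h.trans ?_
  norm_num [Set.mem_univ]

lemma map_linearForm_fst_real {B : Set ℝ} (hB : MeasurableSet B) (u : ℤˣ) :
    ((gaussianMixture p θ S).fst.map (linearForm p w)).real B =
      1 / 2 * (((classLaw p θ S u).map (linearForm p w)).real B +
        ((classLaw p θ S (-u)).map (linearForm p w)).real B) := by
  have hL : Measurable (linearForm p w) := (linearForm p w).continuous.measurable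
  rw [map_measureReal_apply hL hB, map_measureReal_apply hL hB, map_measureReal_apply hL hB,
    measureReal_def, Measure.fst_apply (hL hB), ← measureReal_def,
    gaussianMixture_real p θ (measurable_fst (hL hB)) u]
  rfl

lemma map_neg_map_linearForm_fst (hS : S.PosSemidef) :
    ((gaussianMixture p θ S).fst.map (linearForm p w)).map Neg.neg =
      (gaussianMixture p θ S).fst.map (linearForm p w) := by
  have hneg : ∀ (m : ℝ) (v : NNReal) {B : Set ℝ}, MeasurableSet B →
      (gaussianReal m v).real (Neg.neg ⁻¹' B) = (gaussianReal (-m) v).real B := fun m v B hB => by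
    rw [← gaussianReal_map_neg, map_measureReal_apply measurable_neg hB]
  have := Measure.isProbabilityMeasure_map (μ := (gaussianMixture p θ S).fst)
    (linearForm p w).continuous.measurable.aemeasurable
  ext B hB
  rw [Measure.map_apply measurable_neg hB]
  refine (ENNReal.toReal_eq_toReal_iff' (measure_ne_top _ _) (measure_ne_top _ _)).1 ?_
  simp only [← measureReal_def]
  rw [map_linearForm_fst_real p θ w (measurable_neg hB) 1, map_linearForm_fst_real p θ w hB 1]
  simp only [map_linearForm_classLaw p θ w hS, hneg _ _ hB, Units.val_neg, Int.cast_neg, neg_mul,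
    neg_neg, add_comm]

variable [Fact (1 ≤ p)]

/-- The two classes contribute equally: reflection carries N(-b, v) on [-c, ∞) to N(b, v) on (-∞,
c], so the average collapses to one class. Nonzero variance makes the endpoint negligible. -/
lemma advRisk_gaussianMixture (hS : S.PosSemidef)
    (hv : (w.ofLp ⬝ᵥ S.mulVec w.ofLp).toNNReal ≠ 0) {ε : ℝ} (hε : 0 ≤ ε) (k : ℤˣ) :
    advRisk (gaussianMixture p θ S) ε ((fun z => k * z) ∘ linearSign p w) =
      ((classLaw p θ S k).map (linearForm p w)).real (Set.Iic (‖linearForm p w‖ * ε)) := by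
  have hL : Measurable (linearForm p w) := (linearForm p w).continuous.measurable
  have hset : {z : PiLp p (fun _ : Fin d => ℝ) × ℤˣ | ∃ x' ∈ Metric.closedBall z.1 ε,
      ((fun z => k * z) ∘ linearSign p w) x' ≠ z.2} =
      {z | if k * z.2 = 1 then linearForm p w z.1 < ‖linearForm p w‖ * ε
        else -(‖linearForm p w‖ * ε) ≤ linearForm p w z.1} := by
    ext ⟨x, y⟩
    rw [Set.mem_ofPred_eq, Set.mem_ofPred_eq, ← exists_sgn_ne_iff (linearForm p w) hε x (k * y)]
    refine exists_congr fun x' => and_congr_right fun _ => not_congr ?_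
    rw [linearForm_apply, ← mul_right_inj k (c := k * y), ← mul_assoc, Int.units_mul_self, one_mul]
    rfl
  have hmeas : MeasurableSet {z : PiLp p (fun _ : Fin d => ℝ) × ℤˣ |
      if k * z.2 = 1 then linearForm p w z.1 < ‖linearForm p w‖ * ε
        else -(‖linearForm p w‖ * ε) ≤ linearForm p w z.1} := by
    have hA : MeasurableSet {z : PiLp p (fun _ : Fin d => ℝ) × ℤˣ | k * z.2 = 1} :=
      measurable_snd (Set.toFinite {y : ℤˣ | k * y = 1}).measurableSet
    convert (hA.inter (measurable_fst (hL (measurableSet_Iio (a := ‖linearForm p w‖ * ε))))).union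
      (hA.compl.inter (measurable_fst (hL (measurableSet_Ici (a := -(‖linearForm p w‖ * ε)))))) using 1
    ext z
    by_cases hz : k * z.2 = 1 <;> simp [hz]
  rw [advRisk, hset, gaussianMixture_real p θ hmeas k]
  simp only [Set.mem_ofPred_eq, Int.units_mul_self, if_true, mul_neg,
    if_neg (by decide : ¬ (-1 : ℤˣ) = 1)]
  have h1 := map_measureReal_apply (μ := classLaw p θ S k) hL
    (measurableSet_Iio (a := ‖linearForm p w‖ * ε))
  have h2 := map_measureReal_apply (μ := classLaw p θ S (-k)) hL
    (measurableSet_Ici (a := -(‖linearForm p w‖ * ε)))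
  refine (congrArg₂ (fun a b => 1 / 2 * (a + b)) h1.symm h2.symm).trans ?_
  simp only [map_linearForm_classLaw p θ w hS, gaussianReal_real_Iio_eq hv,
    gaussianReal_real_Ici_eq]
  push_cast
  rw [neg_mul, neg_neg]
  ring

lemma advRisk_zero {X Y : Type*} [MetricSpace X] [MeasurableSpace X] [MeasurableSpace Y]
    (ρ : Measure (X × Y)) (f : X → Y) : advRisk ρ 0 f = risk ρ f := by
  simp [advRisk, risk, Metric.closedBall_zero]

lemma eq_mul_of_nonTrivial {h : ℤˣ → ℤˣ} (hh : NonTrivial h) : h = fun z => h 1 * z := by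
  have hne : h (-1) ≠ h 1 := fun heq => hh ⟨h 1, fun z => by
    rcases Int.units_eq_one_or z with rfl | rfl
    · rfl
    · exact heq⟩
  ext1 z
  rcases Int.units_eq_one_or z with rfl | rfl
  · simp
  · rw [Int.units_ne_iff_eq_neg.1 hne, mul_neg, mul_one]

lemma nonTrivial_mul (k : ℤˣ) : NonTrivial fun z : ℤˣ => k * z := by
  rintro ⟨c, hc⟩
  have := (hc 1).trans (hc (-1)).symm
  rw [mul_right_inj] at this
  exact absurd this (by decide)

end Mixture

end RepVuln

/-! ### Comparison of vulnerability and adversarial gap -/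

theorem theorem3p2 {d : ℕ} (p : ℝ≥0∞) [Fact (1 ≤ p)]
    (θ : EuclideanSpace ℝ (Fin d)) (S : Matrix (Fin d) (Fin d) ℝ) (hS : S.PosDef)
    (ε : ℝ) (hε : 0 ≤ ε)
    (w : EuclideanSpace ℝ (Fin d)) (hw : ‖w‖ = 1)
    (h : ℤˣ → ℤˣ)
    (hopt : RepVuln.IsOptimalDownstream (RepVuln.gaussianMixture p θ S) ε
      (RepVuln.linearSign p w) h) :
    (((∫ t in (1 / 2 - 1 / 2 * RepVuln.advGap (RepVuln.gaussianMixture p θ S) ε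
          (h ∘ RepVuln.linearSign p w))..(1 / 2), deriv Real.binEntropy t : ℝ) : EReal) ≤
      RepVuln.repVulnerability (RepVuln.gaussianMixture p θ S).fst ε (RepVuln.linearSign p w)) ∧
    (RepVuln.repVulnerability (RepVuln.gaussianMixture p θ S).fst ε (RepVuln.linearSign p w) ≤
      ((∫ t in (max 0 (1 / 2 - RepVuln.advGap (RepVuln.gaussianMixture p θ S) ε
          (h ∘ RepVuln.linearSign p w)))..(1 / 2), deriv Real.binEntropy t : ℝ) : EReal)) := by
  open RepVuln in
  have hvar : (w.ofLp ⬝ᵥ S.mulVec w.ofLp).toNNReal ≠ 0 := by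
    have hw0 : w.ofLp ≠ 0 := fun h0 => by
      have : w = 0 := by ext i; simp [h0]
      simp [this] at hw
    have := hS.dotProduct_mulVec_pos hw0
    rw [star_trivial] at this
    exact (Real.toNNReal_pos.2 this).ne'
  obtain ⟨k, hk⟩ : ∃ k, h = fun z => k * z := ⟨_, eq_mul_of_nonTrivial hopt.1⟩
  subst hk
  have hmin := hopt.2 _ (nonTrivial_mul (-k))
  have hmass := fun t => map_linearForm_fst_real p θ w (S := S) (measurableSet_Iic (a := t)) k
  have hsymm := map_neg_map_linearForm_fst p θ w hS.posSemidef
  -- Standard risk is adversarial risk at radius 0, so one formula serves both terms.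
  rw [advGap, ← advRisk_zero, advRisk_gaussianMixture p θ w hS.posSemidef hvar hε,
    advRisk_gaussianMixture p θ w hS.posSemidef hvar le_rfl, mul_zero]
  rw [advRisk_gaussianMixture p θ w hS.posSemidef hvar hε,
    advRisk_gaussianMixture p θ w hS.posSemidef hvar hε] at hmin
  simp only [map_linearForm_classLaw p θ w hS.posSemidef] at hmin hmass ⊢
  have hc : 0 ≤ ‖linearForm p w‖ * ε := by positivity
  set c := ‖linearForm p w‖ * ε with hcdef
  set v := (w.ofLp ⬝ᵥ S.mulVec w.ofLp).toNNReal
  set b := ((k : ℤ) : ℝ) * inner ℝ w θ with hbdef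
  have hnb : (((-k : ℤˣ) : ℤ) : ℝ) * inner ℝ w θ = -b := by
    rw [hbdef]; push_cast; ring
  rw [hnb] at hmin
  simp only [hnb] at hmass
  have hzero : (gaussianReal (-b) v).real (Set.Iic 0) = 1 - (gaussianReal b v).real (Set.Iic 0) := by
    rw [← gaussianReal_real_Ici_eq, neg_zero, ← gaussianReal_real_Iio_eq hvar b,
      ← probReal_compl_eq_one_sub measurableSet_Iio, Set.compl_Iio]
  have hhalf : ((gaussianMixture p θ S).fst.map (linearForm p w)).real (Set.Iic 0) = 1 / 2 := by
    rw [hmass, hzero]; ring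
  -- If b < 0, the flipped classifier -k has strictly smaller risk: its centred cdf is evaluated at
  -- c + b < c - b.
  have hb : 0 ≤ b := by
    by_contra! hb
    rw [gaussianReal_real_Iic_eq b, gaussianReal_real_Iic_eq (-b)] at hmin
    exact absurd hmin (not_le.2 (gaussianReal_real_Iic_lt hvar 0 (by linarith)))
  have hIoc : ∀ m, (gaussianReal m v).real (Set.Ioc 0 c) =
      (gaussianReal m v).real (Set.Iic c) - (gaussianReal m v).real (Set.Iic 0) := fun m => by
    rw [← Set.Iic_sdiff_Iic, measureReal_sdiff (Set.Iic_subset_Iic.2 hc) measurableSet_Iic]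
  have hdom := gaussianReal_real_Ioc_le hvar hb c
  have hneg : 0 ≤ (gaussianReal (-b) v).real (Set.Ioc 0 c) := measureReal_nonneg
  rw [hIoc] at hneg
  rw [hIoc, hIoc] at hdom
  have hrv := repVulnerability_sgn (linearForm p w) hsymm hhalf hε
  have hlin : (fun x => sgn (linearForm p w x)) = linearSign p w := by
    ext1 x; rw [linearForm_apply]; rfl
  -- Passing to 1 - F(c) puts the argument in [0, 1/2], where H₂ increases.
  rw [hlin, hmass, ← hcdef, ← Real.binEntropy_one_sub] at hrv
  have hle1 : (gaussianReal b v).real (Set.Iic c) ≤ 1 := measureReal_le_one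
  have hle1' : (gaussianReal (-b) v).real (Set.Iic c) ≤ 1 := measureReal_le_one
  have hpos : 0 ≤ (gaussianReal b v).real (Set.Iic 0) := measureReal_nonneg
  have hmono := Real.binEntropy_strictMonoOn.monotoneOn
  rw [hrv, EReal.coe_le_coe_iff, EReal.coe_le_coe_iff,
    integral_deriv_binEntropy (by linarith) (by linarith),
    integral_deriv_binEntropy (le_max_left _ _) (max_le (by norm_num) (by linarith))]
  constructor
  · refine sub_le_sub_left (hmono ⟨by linarith, by linarith⟩ ⟨by linarith, by linarith⟩
      (by linarith)) _
  -- The truncation at 0 costs nothing, because 1 - F(c) is itself nonnegative.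
  · refine sub_le_sub_left (hmono ⟨le_max_left _ _, max_le (by norm_num) (by linarith)⟩
      ⟨by linarith, by linarith⟩ (max_le (by linarith) (by linarith))) _
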